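/- Let $(M,H,g)$ be a sub-Riemannian manifold: $M$ is a smooth, finite-dimensional, Hausdorff, second countable manifold without boundary, $HM\subset TM$ is a smooth bracket-generating distribution (a smooth subbundle, locally spanned by smooth frames whose iterated Lie brackets span $TM$), and $g$ is a smooth positive definite quadratic form on $HM$. (Completeness or connectedness of $M$ and absence of abnormal geodesics are not needed.) Write $\|v\|^2=g(v,v)$ for $v\in HM$, let $\pi\colon HM\to M$ be the projection, let $\nabla_H$ be the horizontal gradient, defined by $\langle w,\nabla_H f(x)\rangle=df_x(w)$ for $w\in H_xM$, where $\langle\cdot,\cdot\rangle$ is the scalar product of $g$, and let $I=[0,1]$. Let $\mu_0,\mu_1$ be Borel probability measures on $M$ with compact support. Let $\mathcal Y_{\mu_0}^{\mu_1}(I;HM)$ be the set of Borel probability measures $\eta$ on $I\times HM$ whose marginal on $I$ is the Lebesgue measure and such that, for every $\phi\in C_c^\infty(I\times M)$ (restrictions to $I\times M$ of functions in $C_c^\infty(\mathbb R\times M)$), the function $(t,v)\mapsto\partial_t\phi(t,\pi(v))+\langle v,\nabla_H\phi(t,\pi(v))\rangle$ is $\eta$-integrable and \[ \int_{I\times HM}\bigl(\partial_t\phi(t,\pi(v))+\langle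 v,\nabla_H\phi(t,\pi(v))\rangle\bigr)\,\mathrm d\eta(t,v)=\int_M\phi(1,x)\,\mathrm d\mu_1(x)-\int_M\phi(0,x)\,\mathrm d\mu_0(x). \] Put $J^\star_{BB}(\eta)=\int_{I\times HM}\|v\|^2\,\mathrm d\eta(t,v)\in[0,+\infty]$, and let $\pi_\#\eta$ be the image of $\eta$ under $(t,v)\mapsto(t,\pi(v))$. Then, for every $c\in\mathbb R$ and every compact $K\subset M$, the set \[ \mathcal N(c,K)=\bigl\{\eta\in\mathcal Y_{\mu_0}^{\mu_1}(I;HM):\ J^\star_{BB}(\eta)\le c,\ \pi_\#\eta(I\times K)=1\bigr\} \] is compact with respect to the narrow topology (convergence against bounded continuous functions on $I\times HM$). -/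

import Mathlib

open MeasureTheory Set
open scoped Manifold ContDiff ENNReal unitInterval

noncomputable section

/-- A smooth local frame of the family of tangent subspaces `H` on the set `U`: the fields `X i` are
smooth on `U` and `X 1 (x), …, X m (x)` is a basis of `H x` for every `x ∈ U`. -/
structure IsFrameOn {E : Type*} [NormedAddCommGroup E] [NormedSpace ℝ E] {M : Type*}
    [TopologicalSpace M] [ChartedSpace E M] [IsManifold 𝓘(ℝ, E) ∞ M]
    (H : ∀ x : M, Submodule ℝ (TangentSpace 𝓘(ℝ, E) x)) (U : Set M) {m : ℕ}
    (X : Fin m → ∀ x : M, TangentSpace 𝓘(ℝ, E) x) : Prop where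
  smooth : ∀ i, ContMDiffOn 𝓘(ℝ, E) 𝓘(ℝ, E).tangent ∞
    (fun x => (⟨x, X i x⟩ : TangentBundle 𝓘(ℝ, E) M)) U
  linearIndependent : ∀ x ∈ U, LinearIndependent ℝ (fun i => X i x)
  span_eq : ∀ x ∈ U, Submodule.span ℝ (Set.range fun i => X i x) = H x

/-- The iterated Lie bracket `[X i₁, [X i₂, … [X iₖ₋₁, X iₖ]]]`, where `i = i₁` and
`l = [i₂, …, iₖ]`. -/
def iteratedBracket {E : Type*} [NormedAddCommGroup E] [NormedSpace ℝ E] {M : Type*}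
    [TopologicalSpace M] [ChartedSpace E M] {m : ℕ}
    (X : Fin m → ∀ x : M, TangentSpace 𝓘(ℝ, E) x) :
    Fin m → List (Fin m) → ∀ x : M, TangentSpace 𝓘(ℝ, E) x
  | i, [] => X i
  | i, j :: l => VectorField.mlieBracket 𝓘(ℝ, E) (X i) (iteratedBracket X j l)

/-- A sub-Riemannian structure on the smooth manifold `M`: a smooth distribution `H ⊂ TM`, given by
smooth local frames, that is bracket generating (completely non-integrable), together with a smooth
positive definite quadratic form on `H`, given by its polar form `g`. -/
structure SubRiemannianStructure (E : Type*) [NormedAddCommGroup E] [NormedSpace ℝ E] (M : Type*)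
    [TopologicalSpace M] [ChartedSpace E M] [IsManifold 𝓘(ℝ, E) ∞ M] where
  /-- the horizontal distribution -/
  H : ∀ x : M, Submodule ℝ (TangentSpace 𝓘(ℝ, E) x)
  exists_frame : ∀ x : M, ∃ U : Set M, IsOpen U ∧ x ∈ U ∧
    ∃ (m : ℕ) (X : Fin m → ∀ x : M, TangentSpace 𝓘(ℝ, E) x), IsFrameOn H U X
  bracket_generating : ∀ (x : M) (U : Set M), IsOpen U → x ∈ U →
    ∀ (m : ℕ) (X : Fin m → ∀ x : M, TangentSpace 𝓘(ℝ, E) x), IsFrameOn H U X →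
      ∃ r : ℕ, 1 ≤ r ∧ Submodule.span ℝ
        {w : TangentSpace 𝓘(ℝ, E) x | ∃ (i : Fin m) (l : List (Fin m)),
          l.length + 1 ≤ r ∧ w = iteratedBracket X i l x} = ⊤
  /-- the scalar product on the horizontal spaces -/
  g : ∀ x : M, LinearMap.BilinForm ℝ (H x)
  g_symm : ∀ (x : M) (v w : H x), g x v w = g x w v
  g_pos : ∀ (x : M) (v : H x), v ≠ 0 → 0 < g x v v
  g_smooth : ∀ U : Set M, IsOpen U → ∀ X Y : (∀ x : M, H x),
    ContMDiffOn 𝓘(ℝ, E) 𝓘(ℝ, E).tangent ∞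
      (fun x => (⟨x, (X x).1⟩ : TangentBundle 𝓘(ℝ, E) M)) U →
    ContMDiffOn 𝓘(ℝ, E) 𝓘(ℝ, E).tangent ∞
      (fun x => (⟨x, (Y x).1⟩ : TangentBundle 𝓘(ℝ, E) M)) U →
    ContMDiffOn 𝓘(ℝ, E) 𝓘(ℝ, ℝ) ∞ (fun x => g x (X x) (Y x)) U

namespace SubRiemannianStructure

variable {E : Type*} [NormedAddCommGroup E] [NormedSpace ℝ E] {M : Type*}
  [TopologicalSpace M] [ChartedSpace E M] [IsManifold 𝓘(ℝ, E) ∞ M]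

/-- The horizontal bundle `HM ⊂ TM`. -/
def HorizontalBundle (S : SubRiemannianStructure E M) : Type _ :=
  {v : TangentBundle 𝓘(ℝ, E) M // v.2 ∈ S.H v.1}

instance (S : SubRiemannianStructure E M) : TopologicalSpace S.HorizontalBundle :=
  inferInstanceAs (TopologicalSpace {v : TangentBundle 𝓘(ℝ, E) M // v.2 ∈ S.H v.1})

instance (S : SubRiemannianStructure E M) : MeasurableSpace S.HorizontalBundle := borel _

instance (S : SubRiemannianStructure E M) : BorelSpace S.HorizontalBundle := ⟨rfl⟩

/-- The base point `π(v)` of a horizontal vector `v`. -/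
def proj {S : SubRiemannianStructure E M} (v : S.HorizontalBundle) : M := v.1.1

/-- A horizontal vector as an element of the horizontal space at its base point. -/
def fiber {S : SubRiemannianStructure E M} (v : S.HorizontalBundle) : S.H (proj v) := ⟨v.1.2, v.2⟩

theorem continuous_proj (S : SubRiemannianStructure E M) :
    Continuous (proj : S.HorizontalBundle → M) :=
  (FiberBundle.continuous_proj E (TangentSpace 𝓘(ℝ, E) (M := M))).comp continuous_subtype_val

/-- The sub-Riemannian norm `‖v‖ = √g(v, v)` of a horizontal vector. -/
def hnorm {S : SubRiemannianStructure E M} (v : S.HorizontalBundle) : ℝ :=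
  Real.sqrt (S.g (proj v) (fiber v) (fiber v))

theorem g_nondegenerate (S : SubRiemannianStructure E M) (x : M) : (S.g x).Nondegenerate := by
  constructor
  · intro v hv
    by_contra h
    exact (S.g_pos x v h).ne' (hv v)
  · intro v hv
    by_contra h
    exact (S.g_pos x v h).ne' (hv v)

instance [FiniteDimensional ℝ E] (S : SubRiemannianStructure E M) (x : M) :
    FiniteDimensional ℝ (S.H x) :=
  haveI : FiniteDimensional ℝ (TangentSpace 𝓘(ℝ, E) x) := inferInstanceAs (FiniteDimensional ℝ E)
  inferInstance

/-- The differential of `f` at `x`, restricted to the horizontal space. -/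
def hdiff (S : SubRiemannianStructure E M) (f : M → ℝ) (x : M) : Module.Dual ℝ (S.H x) :=
  (show TangentSpace 𝓘(ℝ, E) x →L[ℝ] ℝ from mfderiv 𝓘(ℝ, E) 𝓘(ℝ, ℝ) f x).toLinearMap ∘ₗ
    (S.H x).subtype

/-- The horizontal gradient `∇_H f(x) ∈ H_x M`, the vector that represents the restriction of
`df(x)` to `H_x M` with respect to the scalar product `g`. -/
def hgrad [FiniteDimensional ℝ E] (S : SubRiemannianStructure E M) (f : M → ℝ) (x : M) : S.H x :=
  ((S.g x).toDual (S.g_nondegenerate x)).symm (S.hdiff f x)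

theorem g_hgrad [FiniteDimensional ℝ E] (S : SubRiemannianStructure E M) (f : M → ℝ) (x : M)
    (w : S.H x) : S.g x w (S.hgrad f x) = mfderiv 𝓘(ℝ, E) 𝓘(ℝ, ℝ) f x w.1 := by
  rw [S.g_symm]
  exact LinearMap.BilinForm.apply_toDual_symm_apply (S.hdiff f x) w

end SubRiemannianStructure

/-- Young measures `𝒴(I; X)`: Borel probability measures on `I × X`, with `I = [0, 1]`, whose first
marginal is the Lebesgue measure. -/
def youngMeasures (X : Type*) [MeasurableSpace X] : Set (ProbabilityMeasure (I × X)) :=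
  {η | (η : Measure (I × X)).map Prod.fst = volume}

namespace SubRiemannianStructure

variable {E : Type*} [NormedAddCommGroup E] [NormedSpace ℝ E] [FiniteDimensional ℝ E] {M : Type*}
  [TopologicalSpace M] [ChartedSpace E M] [IsManifold 𝓘(ℝ, E) ∞ M]

/-- The function `∂ₜφ(t, π(v)) + ⟨v, ∇_H φ(t, π(v))⟩` of `(t, v) ∈ I × HM`. -/
def transportIntegrand (S : SubRiemannianStructure E M) (φ : ℝ × M → ℝ)
    (p : I × S.HorizontalBundle) : ℝ :=
  deriv (fun s : ℝ => φ (s, proj p.2)) (p.1 : ℝ) +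
    S.g (proj p.2) (fiber p.2) (S.hgrad (fun x => φ ((p.1 : ℝ), x)) (proj p.2))

/-- The set `𝒴_{μ₀}^{μ₁}(I; HM)` of Young measures on the horizontal bundle that solve the
continuity equation with values `μ₀`, `μ₁` at the ends of `I`. The test functions, smooth and
compactly supported on `I × M`, are given as restrictions of smooth compactly supported functions
on `ℝ × M`. That the left-hand side of the equation exists is part of the condition. -/
def youngTransport [MeasurableSpace M] (S : SubRiemannianStructure E M)
    (μ₀ μ₁ : ProbabilityMeasure M) : Set (ProbabilityMeasure (I × S.HorizontalBundle)) :=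
  {η | η ∈ youngMeasures S.HorizontalBundle ∧
    ∀ φ : ℝ × M → ℝ, ContMDiff (𝓘(ℝ, ℝ).prod 𝓘(ℝ, E)) 𝓘(ℝ, ℝ) ∞ φ → HasCompactSupport φ →
      Integrable (S.transportIntegrand φ) (η : Measure (I × S.HorizontalBundle)) ∧
      ∫ p, S.transportIntegrand φ p ∂(η : Measure (I × S.HorizontalBundle)) =
        ∫ x, φ (1, x) ∂(μ₁ : Measure M) - ∫ x, φ (0, x) ∂(μ₀ : Measure M)}

/-- The relaxed Benamou–Brenier functional `J(η) = ∫ ‖v‖² dη(t, v) ∈ [0, ∞]`. -/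
def relaxedCost (S : SubRiemannianStructure E M)
    (η : ProbabilityMeasure (I × S.HorizontalBundle)) : ℝ≥0∞ :=
  ∫⁻ p, ENNReal.ofReal (hnorm p.2 ^ 2) ∂(η : Measure (I × S.HorizontalBundle))

/-- The image `π_# η` on `I × M` of a measure `η` on `I × HM`. -/
def baseMeasure [MeasurableSpace M] (S : SubRiemannianStructure E M)
    (η : ProbabilityMeasure (I × S.HorizontalBundle)) : Measure (I × M) :=
  (η : Measure (I × S.HorizontalBundle)).map (fun p => (p.1, proj p.2))

end SubRiemannianStructure

end

/-!
By Prokhorov's theorem a set of probability measures is relatively compact as soon as it is tight.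
For `η` of cost at most `c` that lives over `K`, Chebyshev's inequality bounds the mass outside
`{(t, v) : π(v) ∈ K, ‖v‖ ≤ n + 1}` by `c / (n + 1)` (`measure_compl_le_of_relaxedCost_le`). These
sets are compact (`isCompact_proj_mem_hnorm_le`): in a local frame the metric is a continuous family
of positive definite matrices, so that vectors of bounded norm have bounded coordinates.

The measures with this bound on the mass form a compact set, all members of which live over `K`. It
remains to see that the other conditions are closed. The first marginal depends continuously
on `η`, and the cost is lower semicontinuous, because `‖v‖` is continuous (`continuous_hnorm`). The
continuity equation involves the unbounded function `∂ₜφ + ⟨v, ∇_H φ⟩ = dφ(1, v)`. It is continuous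
(`continuous_transportIntegrand`) and has at most linear growth in `v` over `K`
(`exists_abs_transportIntegrand_le`), so the bound on the cost bounds its second moment. Such a
bound makes it uniformly integrable, and its integral is then continuous in `η`
(`continuousOn_integral_of_lintegral_sq_le`).
-/

open Filter Topology

/-! ### Semicontinuity and continuity of integrals in the narrow topology -/

section NarrowTopology

variable {X : Type*} [TopologicalSpace X] [MeasurableSpace X] [OpensMeasurableSpace X]

/-- Lower semicontinuity of `μ ↦ ∫ f dμ` for a continuous `f ≥ 0` (in general for the positive part
of `f`): the integral is the supremum of the integrals of the truncations `min f n`. -/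
theorem isClosed_setOf_lintegral_le_of_continuous {f : X → ℝ} (hf : Continuous f)
    (c : ℝ≥0∞) :
    IsClosed {μ : ProbabilityMeasure X | ∫⁻ x, ENNReal.ofReal (f x) ∂(μ : Measure X) ≤ c} := by
  let g : ℕ → BoundedContinuousFunction X NNReal := fun n =>
    BoundedContinuousFunction.mkOfBound ⟨fun x => min (f x).toNNReal n, by fun_prop⟩ n (by
      intro x y
      rw [NNReal.dist_eq, abs_sub_le_iff]
      have h1 : (min (f x).toNNReal (n : NNReal) : NNReal) ≤ n := min_le_right _ _
      have h2 : (min (f y).toNNReal (n : NNReal) : NNReal) ≤ n := min_le_right _ _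
      have h1' : ((min (f x).toNNReal (n : NNReal) : NNReal) : ℝ) ≤ n := by exact_mod_cast h1
      have h2' : ((min (f y).toNNReal (n : NNReal) : NNReal) : ℝ) ≤ n := by exact_mod_cast h2
      have h3 := (min (f x).toNNReal (n : NNReal)).2
      have h4 := (min (f y).toNNReal (n : NNReal)).2
      simp only [NNReal.val_eq_coe] at h3 h4
      constructor <;> simp only [ContinuousMap.coe_mk] <;> linarith)
  have hg : ∀ n x, (g n x : ℝ≥0∞) = min (ENNReal.ofReal (f x)) n := by
    intro n x
    change ((min (f x).toNNReal n : NNReal) : ℝ≥0∞) = _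
    rw [ENNReal.coe_min]; rfl
  have key : {μ : ProbabilityMeasure X | ∫⁻ x, ENNReal.ofReal (f x) ∂(μ : Measure X) ≤ c} =
      ⋂ n, {μ : ProbabilityMeasure X | ∫⁻ x, (g n x : ℝ≥0∞) ∂(μ : Measure X) ≤ c} := by
    ext μ
    simp only [mem_ofPred_eq, mem_iInter]
    have hsup : ∫⁻ x, ENNReal.ofReal (f x) ∂(μ : Measure X) =
        ⨆ n, ∫⁻ x, (g n x : ℝ≥0∞) ∂(μ : Measure X) := by
      rw [← lintegral_iSup]
      · refine lintegral_congr fun x => ?_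
        simp only [hg]
        rw [← inf_iSup_eq (ENNReal.ofReal (f x)) (fun n : ℕ => (n : ℝ≥0∞)), ENNReal.iSup_natCast]
        simp
      · intro n
        exact (ENNReal.continuous_coe.comp (g n).continuous).measurable
      · intro m n hmn x
        simp only [hg]
        exact min_le_min_left _ (by exact_mod_cast hmn)
    rw [hsup, iSup_le_iff]
  rw [key]
  exact isClosed_iInter fun n =>
    isClosed_le (ProbabilityMeasure.continuous_lintegral_boundedContinuousFunction (g n))
      continuous_const

theorem integrable_of_lintegral_sq_le {F : X → ℝ} (hF : Continuous F) {C : ℝ}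
    {μ : ProbabilityMeasure X}
    (h : ∫⁻ x, ENNReal.ofReal (F x ^ 2) ∂(μ : Measure X) ≤ ENNReal.ofReal C) :
    Integrable F (μ : Measure X) ∧ Integrable (fun x => F x ^ 2) (μ : Measure X) := by
  have h2 : Integrable (fun x => F x ^ 2) (μ : Measure X) := by
    refine ⟨(hF.pow 2).measurable.aestronglyMeasurable, ?_⟩
    rw [hasFiniteIntegral_iff_ofReal (Eventually.of_forall fun x => sq_nonneg _)]
    exact h.trans_lt ENNReal.ofReal_lt_top
  refine ⟨((integrable_const (1 : ℝ)).add h2).mono' hF.measurable.aestronglyMeasurable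
    (Eventually.of_forall fun x => ?_), h2⟩
  simp only [Real.norm_eq_abs, Pi.add_apply]
  nlinarith [sq_abs (F x), sq_nonneg (|F x| - 1)]

/-- Under a uniform bound on the second moments of `F`, the narrow topology passes to the limit in
the integral of the unbounded continuous function `F`. The truncations `max (-n) (min n F)` satisfy
`n |F - Fₙ| ≤ F²`, so their integrals converge uniformly. -/
theorem continuousOn_integral_of_lintegral_sq_le {F : X → ℝ} (hF : Continuous F) (C : ℝ) :
    ContinuousOn (fun μ : ProbabilityMeasure X => ∫ x, F x ∂(μ : Measure X))
      {μ | ∫⁻ x, ENNReal.ofReal (F x ^ 2) ∂(μ : Measure X) ≤ ENNReal.ofReal C} := by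
  let G : ℕ → BoundedContinuousFunction X ℝ := fun n =>
    BoundedContinuousFunction.ofNormedAddCommGroup (fun x => max (-(n : ℝ)) (min n (F x)))
      (by fun_prop) n (by
        intro x
        rw [Real.norm_eq_abs, abs_le]
        exact ⟨le_max_left _ _, max_le (by linarith [Nat.cast_nonneg (α := ℝ) n])
          (min_le_left _ _)⟩)
  have hG : ∀ (n : ℕ) (x : X), (n : ℝ) * |F x - G n x| ≤ F x ^ 2 := by
    intro n x
    change (n : ℝ) * |F x - max (-(n : ℝ)) (min n (F x))| ≤ F x ^ 2
    have hn : (0 : ℝ) ≤ n := Nat.cast_nonneg n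
    rcases le_total (F x) n with h1 | h1
    · rw [min_eq_right h1]
      rcases le_total (-(n : ℝ)) (F x) with h2 | h2
      · rw [max_eq_right h2]; simp [sq_nonneg]
      · rw [max_eq_left h2, abs_of_nonpos (by linarith)]
        nlinarith
    · rw [min_eq_left h1, max_eq_right (by linarith), abs_of_nonneg (by linarith)]
      nlinarith
  have hu : TendstoUniformlyOn (fun (n : ℕ) (μ : ProbabilityMeasure X) =>
      ∫ x, G n x ∂(μ : Measure X)) (fun μ => ∫ x, F x ∂(μ : Measure X)) atTop
      {μ | ∫⁻ x, ENNReal.ofReal (F x ^ 2) ∂(μ : Measure X) ≤ ENNReal.ofReal C} := by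
    rw [Metric.tendstoUniformlyOn_iff]
    intro ε hε
    obtain ⟨n₀, hn₀⟩ := exists_nat_gt (max C 0 / ε)
    filter_upwards [eventually_ge_atTop n₀] with n hn μ hμ
    obtain ⟨hi, hi2⟩ := integrable_of_lintegral_sq_le hF hμ
    have hn' : max C 0 / ε < n := hn₀.trans_le (by exact_mod_cast hn)
    have hnpos : (0 : ℝ) < n := lt_of_le_of_lt (by positivity) hn'
    have hC : ∫ x, F x ^ 2 ∂(μ : Measure X) ≤ max C 0 := by
      rw [integral_eq_lintegral_of_nonneg_ae (Eventually.of_forall fun x => sq_nonneg _)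
        (hF.pow 2).measurable.aestronglyMeasurable]
      refine (ENNReal.toReal_mono ENNReal.ofReal_ne_top hμ).trans ?_
      rw [ENNReal.toReal_ofReal']
    have hGi : Integrable (fun x => G n x) (μ : Measure X) := (G n).integrable _
    rw [Real.dist_eq, ← integral_sub hi hGi]
    have h1 : (n : ℝ) * |∫ x, (F x - G n x) ∂(μ : Measure X)| ≤ max C 0 := by
      calc (n : ℝ) * |∫ x, (F x - G n x) ∂(μ : Measure X)|
          ≤ n * ∫ x, |F x - G n x| ∂(μ : Measure X) := by
            gcongr; exact abs_integral_le_integral_abs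
        _ = ∫ x, n * |F x - G n x| ∂(μ : Measure X) := (integral_const_mul _ _).symm
        _ ≤ ∫ x, F x ^ 2 ∂(μ : Measure X) :=
            integral_mono ((hi.sub hGi).abs.const_mul _) hi2 (hG n)
        _ ≤ max C 0 := hC
    rw [div_lt_iff₀ hε] at hn'
    exact lt_of_mul_lt_mul_left (h1.trans_lt hn') hnpos.le
  exact hu.continuousOn (Frequently.of_forall fun n =>
    (ProbabilityMeasure.continuous_integral_boundedContinuousFunction (G n)).continuousOn)

theorem isClosed_youngMeasures : IsClosed (youngMeasures X) := by
  let vol : ProbabilityMeasure I := ⟨volume, inferInstance⟩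
  have h : youngMeasures X = {η | η.map (f := Prod.fst) measurable_fst.aemeasurable = vol} := by
    ext η
    exact ⟨fun hη => Subtype.ext hη, fun hη => congrArg Subtype.val hη⟩
  rw [h]
  exact isClosed_eq (ProbabilityMeasure.continuous_map continuous_fst) continuous_const

end NarrowTopology

/-! ### Topology of the horizontal bundle -/

section HorizontalBundle

namespace SubRiemannianStructure

variable {E : Type*} [NormedAddCommGroup E] [NormedSpace ℝ E] {M : Type*}
  [TopologicalSpace M] [ChartedSpace E M] [IsManifold 𝓘(ℝ, E) ∞ M]

/-- The point of the horizontal bundle given by a horizontal vector at `x`. -/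
def mkHorizontal (S : SubRiemannianStructure E M) (x : M) (h : S.H x) : S.HorizontalBundle :=
  ⟨⟨x, h.1⟩, h.2⟩

theorem mkHorizontal_fiber {S : SubRiemannianStructure E M} (v : S.HorizontalBundle) :
    S.mkHorizontal (proj v) (fiber v) = v := rfl

theorem isInducing_coe (S : SubRiemannianStructure E M) :
    IsInducing (fun v : S.HorizontalBundle => v.1) :=
  IsInducing.subtypeVal

theorem continuous_coe (S : SubRiemannianStructure E M) :
    Continuous (fun v : S.HorizontalBundle => v.1) :=
  S.isInducing_coe.continuous

/-- Two vectors with distinct base points are separated by the projection, two vectors with the same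
base point by a trivialization. -/
theorem t2Space_tangentBundle [T2Space M] : T2Space (TangentBundle 𝓘(ℝ, E) M) := by
  refine ⟨fun v w hvw => ?_⟩
  by_cases h : v.1 = w.1
  · let e := trivializationAt E (TangentSpace 𝓘(ℝ, E) (M := M)) v.1
    have hv : v ∈ e.source := FiberBundle.mem_trivializationAt_proj_source
    have hw : w ∈ e.source := by
      rw [e.mem_source, ← h]
      exact FiberBundle.mem_baseSet_trivializationAt' v.1
    obtain ⟨O, P, hO, hP, hvO, hwP, hOP⟩ := t2_separation (fun he => hvw (e.injOn hv hw he))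
    refine ⟨e.source ∩ e ⁻¹' O, e.source ∩ e ⁻¹' P, e.isOpen_inter_preimage hO,
      e.isOpen_inter_preimage hP, ⟨hv, hvO⟩, ⟨hw, hwP⟩, ?_⟩
    exact (hOP.preimage e).mono inter_subset_right inter_subset_right
  · exact separated_by_continuous
      (FiberBundle.continuous_proj E (TangentSpace 𝓘(ℝ, E) (M := M))) h

instance [T2Space M] (S : SubRiemannianStructure E M) : T2Space S.HorizontalBundle :=
  haveI : T2Space (TangentBundle 𝓘(ℝ, E) M) := t2Space_tangentBundle
  inferInstanceAs (T2Space {v : TangentBundle 𝓘(ℝ, E) M // v.2 ∈ S.H v.1})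

/-- Near every point the distribution has a frame consisting of globally defined sections that are
smooth near that point. -/
theorem exists_local_frame (S : SubRiemannianStructure E M) (x₀ : M) :
    ∃ U : Set M, IsOpen U ∧ x₀ ∈ U ∧ ∃ (m : ℕ) (X : Fin m → ∀ x : M, S.H x),
      (∀ i, ContMDiffOn 𝓘(ℝ, E) 𝓘(ℝ, E).tangent ∞
        (fun x => (⟨x, (X i x).1⟩ : TangentBundle 𝓘(ℝ, E) M)) U) ∧
      (∀ x ∈ U, LinearIndependent ℝ fun i => X i x) ∧
      ∀ x ∈ U, ∀ h : S.H x, ∃ a : Fin m → ℝ, ∑ i, a i • X i x = h := by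
  classical
  obtain ⟨U, hU, hx₀, m, X, hX⟩ := S.exists_frame x₀
  have hmem : ∀ i, ∀ x ∈ U, X i x ∈ S.H x := fun i x hx => by
    rw [← hX.span_eq x hx]
    exact Submodule.subset_span ⟨i, rfl⟩
  let Y : Fin m → ∀ x : M, S.H x := fun i x => if hx : x ∈ U then ⟨X i x, hmem i x hx⟩ else 0
  have hY : ∀ i, ∀ x ∈ U, (Y i x).1 = X i x := fun i x hx => by simp [Y, hx]
  refine ⟨U, hU, hx₀, m, Y, fun i => ?_, fun x hx => ?_, fun x hx h => ?_⟩
  · exact (hX.smooth i).congr fun x hx => by rw [hY i x hx]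
  · refine LinearIndependent.of_comp (S.H x).subtype ?_
    convert hX.linearIndependent x hx using 1
    ext1 i
    exact hY i x hx
  · have hh : h.1 ∈ Submodule.span ℝ (range fun i => X i x) := by
      rw [hX.span_eq x hx]
      exact h.2
    obtain ⟨a, ha⟩ := (Submodule.mem_span_range_iff_exists_fun ℝ).1 hh
    refine ⟨a, Subtype.ext ?_⟩
    rw [← ha, Submodule.coe_sum]
    exact Finset.sum_congr rfl fun i _ => by rw [Submodule.coe_smul, hY i x hx]

theorem trivialization_sum_smul {x₀ x : M}
    (hx : x ∈ (trivializationAt E (TangentSpace 𝓘(ℝ, E) (M := M)) x₀).baseSet) {m : ℕ}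
    (a : Fin m → ℝ) (X : Fin m → TangentSpace 𝓘(ℝ, E) x) :
    (trivializationAt E (TangentSpace 𝓘(ℝ, E) (M := M)) x₀ ⟨x, ∑ i, a i • X i⟩).2 =
      ∑ i, a i • (trivializationAt E (TangentSpace 𝓘(ℝ, E) (M := M)) x₀ ⟨x, X i⟩).2 := by
  have h := fun v => (trivializationAt E (TangentSpace 𝓘(ℝ, E) (M := M)) x₀).linearEquivAt_apply
    (R := ℝ) x hx v
  simp only [← h, map_sum, map_smul]

theorem g_sum_smul (S : SubRiemannianStructure E M) {x : M} {m : ℕ} (a : Fin m → ℝ)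
    (X : Fin m → S.H x) :
    S.g x (∑ i, a i • X i) (∑ i, a i • X i) = ∑ i, ∑ j, a i * (a j * S.g x (X i) (X j)) := by
  simp only [map_sum, map_smul, LinearMap.sum_apply, LinearMap.smul_apply, smul_eq_mul,
    Finset.mul_sum]
  rw [Finset.sum_comm]
  refine Finset.sum_congr rfl fun i _ => Finset.sum_congr rfl fun j _ => by ring

/-- A section that is smooth near `x₀` is continuous at `x₀` when read in the trivialization of the
tangent bundle there. -/
theorem continuousAt_frame {x₀ : M} {U : Set M} (hU : IsOpen U) (hx₀ : x₀ ∈ U)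
    {S : SubRiemannianStructure E M} {X : ∀ x : M, S.H x}
    (hX : ContMDiffOn 𝓘(ℝ, E) 𝓘(ℝ, E).tangent ∞
        (fun x => (⟨x, (X x).1⟩ : TangentBundle 𝓘(ℝ, E) M)) U) :
    ContinuousAt (fun x => (trivializationAt E (TangentSpace 𝓘(ℝ, E) (M := M)) x₀
      ⟨x, (X x).1⟩).2) x₀ :=
  (FiberBundle.continuousAt_section (F := E) (E := TangentSpace 𝓘(ℝ, E) (M := M))
    (s := fun x => (X x).1) x₀).1 (hX.continuousOn.continuousAt (hU.mem_nhds hx₀))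

/-- Near a point of the horizontal bundle, `g(v, v) = ∑ᵢⱼ aᵢ(v) aⱼ(v) gᵢⱼ(π(v))`, where `gᵢⱼ` are
the coefficients of the metric in a local frame and `a(v)` are the coordinates of `v` in it; these
coordinates depend continuously on `v`. -/
theorem continuous_g_fiber [FiniteDimensional ℝ E] (S : SubRiemannianStructure E M) :
    Continuous fun v : S.HorizontalBundle => S.g (proj v) (fiber v) (fiber v) := by
  rw [continuous_iff_continuousAt]
  intro v₀
  obtain ⟨U, hU, hx₀, m, X, hXs, hXi, hXg⟩ := S.exists_local_frame (proj v₀)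
  set x₀ := proj v₀ with hx₀_def
  let e := trivializationAt E (TangentSpace 𝓘(ℝ, E) (M := M)) x₀
  have hbase : x₀ ∈ e.baseSet := FiberBundle.mem_baseSet_trivializationAt' x₀
  let A : Fin m → M → E := fun i x => (e ⟨x, (X i x).1⟩).2
  have hA : ∀ i, ContinuousAt (A i) x₀ := fun i => continuousAt_frame hU hx₀ (hXs i)
  have hind : LinearIndependent ℝ fun i => A i x₀ := by
    have h1 := (hXi x₀ hx₀).map' (S.H x₀).subtype (Submodule.ker_subtype _)
    exact h1.map' (e.linearEquivAt ℝ x₀ hbase).toLinearMap (LinearEquiv.ker _)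
  -- `B` recovers coordinates in the frame at `x₀`; near `x₀` it does so up to the matrix `N x`,
  -- which is close to the identity
  obtain ⟨B, hB⟩ := LinearMap.exists_leftInverse_of_injective
    (Fintype.linearCombination ℝ fun i => A i x₀)
    (LinearMap.ker_eq_bot.2
      (linearIndependent_iff_injective_fintypeLinearCombination.1 hind))
  have hBc : Continuous B := B.continuous_of_finiteDimensional
  let N : M → Matrix (Fin m) (Fin m) ℝ := fun x => Matrix.of fun i j => B (A j x) i
  have hN : ContinuousAt N x₀ := by
    refine continuousAt_pi.2 fun i => continuousAt_pi.2 fun j => ?_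
    exact ((continuous_apply i).comp hBc).continuousAt.comp (hA j)
  have hN₀ : N x₀ = 1 := by
    ext i j
    have := congrFun (LinearMap.congr_fun hB (Pi.single j 1)) i
    simp only [LinearMap.comp_apply, Fintype.linearCombination_apply_single, one_smul,
      LinearMap.id_apply] at this
    change B (A j x₀) i = _
    rw [this, Matrix.one_apply, Pi.single_apply]
  have hπ : ContinuousAt (proj : S.HorizontalBundle → M) v₀ := S.continuous_proj.continuousAt
  have hNπ : ContinuousAt (fun v : S.HorizontalBundle => N (proj v)) v₀ :=
    ContinuousAt.comp (g := N) hN hπ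
  have hdet : ∀ᶠ v in 𝓝 v₀, (N (proj v)).det ≠ 0 := by
    have hc : ContinuousAt (fun v : S.HorizontalBundle => (N (proj v)).det) v₀ :=
      (Continuous.matrix_det continuous_id).continuousAt.comp hNπ
    refine hc.eventually_ne ?_
    rw [← hx₀_def, hN₀, Matrix.det_one]
    exact one_ne_zero
  have hNinv : ContinuousAt (fun v : S.HorizontalBundle => (N (proj v))⁻¹) v₀ := by
    refine ContinuousAt.comp (g := fun P : Matrix (Fin m) (Fin m) ℝ => P⁻¹)
      (continuousAt_matrix_inv _ ?_) hNπ
    have : (N (proj v₀)).det = 1 := by rw [← hx₀_def, hN₀, Matrix.det_one]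
    rw [this, Ring.inverse_eq_inv']
    exact continuousAt_inv₀ one_ne_zero
  have hev : ContinuousAt (fun v : S.HorizontalBundle => (e v.1).2) v₀ :=
    ((FiberBundle.continuousAt_totalSpace E _).1 S.continuous_coe.continuousAt).2
  -- the coordinates of `v` in the frame, obtained by inverting the matrix `N`
  let a : S.HorizontalBundle → Fin m → ℝ := fun v => (N (proj v))⁻¹.mulVec (B (e v.1).2)
  have ha : ContinuousAt a v₀ := by
    have hBe : ContinuousAt (fun v : S.HorizontalBundle => B (e v.1).2) v₀ :=
      hBc.continuousAt.comp hev
    exact (Continuous.matrix_mulVec continuous_fst continuous_snd).continuousAt.comp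
      (hNinv.prodMk hBe)
  have hag : ∀ᶠ v in 𝓝 v₀, S.g (proj v) (fiber v) (fiber v) =
      ∑ i, ∑ j, a v i * (a v j * S.g (proj v) (X i (proj v)) (X j (proj v))) := by
    filter_upwards [hdet, hπ.preimage_mem_nhds (hU.mem_nhds hx₀),
      hπ.preimage_mem_nhds (e.open_baseSet.mem_nhds hbase)] with v hv hvU hve
    obtain ⟨b, hb⟩ := hXg (proj v) hvU (fiber v)
    have hab : a v = b := by
      have h1 : B (e v.1).2 = (N (proj v)).mulVec b := by
        have h2 : (e v.1).2 = ∑ i, b i • A i (proj v) := by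
          rw [← trivialization_sum_smul hve]
          have h3 : ∑ i, b i • (X i (proj v)).1 = v.1.2 := by
            have := congrArg Subtype.val hb
            rw [Submodule.coe_sum] at this
            exact this
          rw [h3]; rfl
        rw [h2, map_sum]
        ext i
        simp [Matrix.mulVec, dotProduct, N, mul_comm]
      change (N (proj v))⁻¹.mulVec (B (e v.1).2) = b
      rw [h1, Matrix.mulVec_mulVec, Matrix.nonsing_inv_mul _ (isUnit_iff_ne_zero.2 hv),
        Matrix.one_mulVec]
    rw [← g_sum_smul, hab, hb]
  refine ContinuousAt.congr ?_ (hag.mono fun v hv => hv.symm)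
  refine tendsto_finsetSum _ fun i _ => tendsto_finsetSum _ fun j _ => ?_
  have hai := fun i => (continuous_apply i).continuousAt.comp ha
  refine (hai i).mul ((hai j).mul ?_)
  have hg : ContinuousAt (fun x => S.g x (X i x) (X j x)) x₀ :=
    (S.g_smooth U hU (X i) (X j) (hXs i) (hXs j)).continuousOn.continuousAt (hU.mem_nhds hx₀)
  exact ContinuousAt.comp (f := (proj : S.HorizontalBundle → M)) hg hπ

theorem hnorm_nonneg {S : SubRiemannianStructure E M} (v : S.HorizontalBundle) : 0 ≤ hnorm v :=
  Real.sqrt_nonneg _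

theorem continuous_hnorm [FiniteDimensional ℝ E] (S : SubRiemannianStructure E M) :
    Continuous (hnorm : S.HorizontalBundle → ℝ) :=
  S.continuous_g_fiber.sqrt

theorem hnorm_mkHorizontal_smul (S : SubRiemannianStructure E M) (x : M) (r : ℝ) (h : S.H x) :
    hnorm (S.mkHorizontal x (r • h)) = |r| * hnorm (S.mkHorizontal x h) := by
  change Real.sqrt (S.g x (r • h) (r • h)) = |r| * Real.sqrt (S.g x h h)
  rw [map_smul, map_smul, LinearMap.smul_apply, smul_eq_mul, smul_eq_mul, ← mul_assoc,
    Real.sqrt_mul (mul_self_nonneg r), Real.sqrt_mul_self_eq_abs]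

theorem hnorm_mkHorizontal_pos (S : SubRiemannianStructure E M) (x : M) {h : S.H x} (h0 : h ≠ 0) :
    0 < hnorm (S.mkHorizontal x h) :=
  Real.sqrt_pos.2 (S.g_pos x h h0)

/-- The map `(x, a) ↦ ∑ aᵢ Xᵢ(x)` that parametrizes the horizontal bundle over the domain of a
smooth frame is continuous. -/
theorem continuousOn_mkHorizontal_sum {S : SubRiemannianStructure E M} {U : Set M} (hU : IsOpen U)
    {m : ℕ} {X : Fin m → ∀ x : M, S.H x}
    (hX : ∀ i, ContMDiffOn 𝓘(ℝ, E) 𝓘(ℝ, E).tangent ∞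
        (fun x => (⟨x, (X i x).1⟩ : TangentBundle 𝓘(ℝ, E) M)) U) :
    ContinuousOn (fun p : M × (Fin m → ℝ) => S.mkHorizontal p.1 (∑ i, p.2 i • X i p.1))
      (U ×ˢ univ) := by
  rintro ⟨x₀, a₀⟩ ⟨hx₀, -⟩
  refine ContinuousAt.continuousWithinAt ?_
  rw [S.isInducing_coe.continuousAt_iff]
  refine (FiberBundle.continuousAt_totalSpace E _).2 ⟨continuousAt_fst, ?_⟩
  let e := trivializationAt E (TangentSpace 𝓘(ℝ, E) (M := M)) x₀
  have hbase : x₀ ∈ e.baseSet := FiberBundle.mem_baseSet_trivializationAt' x₀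
  have hev : ∀ᶠ p : M × (Fin m → ℝ) in 𝓝 (x₀, a₀),
      (e (S.mkHorizontal p.1 (∑ i, p.2 i • X i p.1)).1).2 =
        ∑ i, p.2 i • (e ⟨p.1, (X i p.1).1⟩).2 := by
    filter_upwards [continuousAt_fst.preimage_mem_nhds (e.open_baseSet.mem_nhds hbase)] with p hp
    rw [← trivialization_sum_smul hp]
    have : (S.mkHorizontal p.1 (∑ i, p.2 i • X i p.1)).1 =
        (⟨p.1, ∑ i, p.2 i • (X i p.1).1⟩ : TangentBundle 𝓘(ℝ, E) M) := by
      change (⟨p.1, ((∑ i, p.2 i • X i p.1 : S.H p.1) : TangentSpace 𝓘(ℝ, E) p.1)⟩ :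
        TangentBundle 𝓘(ℝ, E) M) = _
      rw [Submodule.coe_sum]
      rfl
    rw [this]
  refine ContinuousAt.congr ?_ (hev.mono fun p hp => hp.symm)
  refine tendsto_finsetSum _ fun i _ => ?_
  have h1 : ContinuousAt (fun p : M × (Fin m → ℝ) => p.2 i) (x₀, a₀) :=
    ((continuous_apply i).comp continuous_snd).continuousAt
  have h2 : ContinuousAt (fun p : M × (Fin m → ℝ) => (e ⟨p.1, (X i p.1).1⟩).2) (x₀, a₀) :=
    ContinuousAt.comp (g := fun x => (e ⟨x, (X i x).1⟩).2) (f := Prod.fst)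
      (continuousAt_frame hU hx₀ (hX i)) continuousAt_fst
  exact h1.smul h2

/-- Over a compact neighbourhood contained in the domain of a frame, the coordinates of horizontal
vectors of bounded norm are bounded, since the norm is bounded below on unit coordinate vectors. -/
theorem exists_nhds_isCompact_hnorm_le [FiniteDimensional ℝ E] (S : SubRiemannianStructure E M)
    (R : ℝ) (x₀ : M) :
    ∃ V ∈ 𝓝 x₀, ∃ D : Set S.HorizontalBundle, IsCompact D ∧
      ∀ v : S.HorizontalBundle, proj v ∈ V → hnorm v ≤ R → v ∈ D := by
  have : LocallyCompactSpace M := ChartedSpace.locallyCompactSpace E M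
  obtain ⟨U, hU, hx₀, m, X, hXs, hXi, hXg⟩ := S.exists_local_frame x₀
  obtain ⟨V, hV, hVU, hVc⟩ := local_compact_nhds (hU.mem_nhds hx₀)
  let Φ : M × (Fin m → ℝ) → S.HorizontalBundle :=
    fun p => S.mkHorizontal p.1 (∑ i, p.2 i • X i p.1)
  have hΦ : ContinuousOn Φ (V ×ˢ univ) :=
    (continuousOn_mkHorizontal_sum hU hXs).mono (prod_mono hVU subset_rfl)
  have hsph : IsCompact (V ×ˢ Metric.sphere (0 : Fin m → ℝ) 1) := hVc.prod (isCompact_sphere _ _)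
  obtain ⟨δ, hδ, hδle⟩ := hsph.exists_forall_le' (f := fun p => hnorm (Φ p)) (a := 0)
    (S.continuous_hnorm.comp_continuousOn (hΦ.mono (prod_mono subset_rfl (subset_univ _))))
    (by
      rintro ⟨x, a⟩ ⟨hx, ha⟩
      refine S.hnorm_mkHorizontal_pos x fun h0 => ?_
      have ha0 : a = 0 := funext (Fintype.linearIndependent_iff.1 (hXi x (hVU hx)) a h0)
      simp [ha0] at ha)
  refine ⟨V, hV, Φ '' (V ×ˢ Metric.closedBall 0 (R / δ)),
    (hVc.prod (isCompact_closedBall _ _)).image_of_continuousOn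
      (hΦ.mono (prod_mono subset_rfl (subset_univ _))), fun v hv hvR => ?_⟩
  obtain ⟨a, ha⟩ := hXg (proj v) (hVU hv) (fiber v)
  have hva : Φ (proj v, a) = v := by
    change S.mkHorizontal (proj v) (∑ i, a i • X i (proj v)) = v
    rw [ha, mkHorizontal_fiber]
  refine ⟨(proj v, a), ⟨hv, ?_⟩, hva⟩
  rw [mem_closedBall_zero_iff, le_div_iff₀ hδ]
  refine le_trans ?_ hvR
  by_cases ha0 : a = 0
  · simpa [ha0] using hnorm_nonneg v
  have hna : ‖a‖ ≠ 0 := norm_ne_zero_iff.2 ha0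
  have h1 : δ ≤ hnorm (Φ (proj v, ‖a‖⁻¹ • a)) :=
    hδle (proj v, ‖a‖⁻¹ • a) ⟨hv, by simp [norm_smul, hna]⟩
  have h2 : hnorm (Φ (proj v, ‖a‖⁻¹ • a)) = ‖a‖⁻¹ * hnorm v := by
    have h3 : Φ (proj v, ‖a‖⁻¹ • a) = S.mkHorizontal (proj v) (‖a‖⁻¹ • fiber v) := by
      change S.mkHorizontal (proj v) (∑ i, (‖a‖⁻¹ • a) i • X i (proj v)) = _
      rw [← ha, Finset.smul_sum]
      simp only [Pi.smul_apply, smul_assoc]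
    rw [h3, hnorm_mkHorizontal_smul, mkHorizontal_fiber, abs_of_nonneg (by positivity)]
  rw [h2] at h1
  calc ‖a‖ * δ ≤ ‖a‖ * (‖a‖⁻¹ * hnorm v) := by gcongr
    _ = hnorm v := by field_simp

theorem isCompact_proj_mem_hnorm_le [FiniteDimensional ℝ E] [T2Space M]
    (S : SubRiemannianStructure E M) {K : Set M} (hK : IsCompact K) (R : ℝ) :
    IsCompact {v : S.HorizontalBundle | proj v ∈ K ∧ hnorm v ≤ R} := by
  choose V hV D hD hVD using S.exists_nhds_isCompact_hnorm_le R
  obtain ⟨t, -, ht⟩ := hK.elim_nhds_subcover V fun x _ => hV x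
  refine (t.isCompact_biUnion fun x _ => hD x).of_isClosed_subset
    ((hK.isClosed.preimage S.continuous_proj).inter
      (isClosed_le S.continuous_hnorm continuous_const)) fun v hv => ?_
  obtain ⟨x, hx, hvx⟩ := mem_iUnion₂.1 (ht hv.1)
  exact mem_iUnion₂.2 ⟨x, hx, hVD x v hvx hv.2⟩

end SubRiemannianStructure

end HorizontalBundle

/-! ### The integrand of the continuity equation -/

section TransportIntegrand

namespace SubRiemannianStructure

variable {E : Type*} [NormedAddCommGroup E] [NormedSpace ℝ E] [FiniteDimensional ℝ E] {M : Type*}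
  [TopologicalSpace M] [ChartedSpace E M] [IsManifold 𝓘(ℝ, E) ∞ M]

theorem transportIntegrand_mkHorizontal (S : SubRiemannianStructure E M) (φ : ℝ × M → ℝ)
    (t : I) (x : M) (h : S.H x) :
    S.transportIntegrand φ (t, S.mkHorizontal x h) =
      deriv (fun s : ℝ => φ (s, x)) (t : ℝ) + S.g x h (S.hgrad (fun y => φ ((t : ℝ), y)) x) :=
  rfl

/-- The integrand at `(t, v)` is the differential of `φ` at `(t, π(v))`, applied to `(1, v)`. -/
theorem transportIntegrand_eq_tangentMap (S : SubRiemannianStructure E M) {φ : ℝ × M → ℝ}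
    (hφ : ContMDiff (𝓘(ℝ, ℝ).prod 𝓘(ℝ, E)) 𝓘(ℝ, ℝ) ∞ φ) (t : I) (v : S.HorizontalBundle) :
    S.transportIntegrand φ (t, v) =
      (tangentMap (𝓘(ℝ, ℝ).prod 𝓘(ℝ, E)) 𝓘(ℝ, ℝ) φ
        ((equivTangentBundleProd 𝓘(ℝ, ℝ) ℝ 𝓘(ℝ, E) M).symm (⟨(t : ℝ), (1 : ℝ)⟩, v.1))).2 := by
  have hd : MDifferentiableAt (𝓘(ℝ, ℝ).prod 𝓘(ℝ, E)) 𝓘(ℝ, ℝ) φ ((t : ℝ), proj v) :=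
    hφ.mdifferentiable (by simp) _
  let w : TangentSpace (𝓘(ℝ, ℝ).prod 𝓘(ℝ, E)) ((t : ℝ), proj v) := ((1 : ℝ), v.1.2)
  refine Eq.trans ?_ (mfderiv_prod_eq_add_apply (v := w) hd).symm
  rw [← mkHorizontal_fiber v, transportIntegrand_mkHorizontal, g_hgrad, mfderiv_eq_fderiv]
  rfl

theorem continuous_transportIntegrand (S : SubRiemannianStructure E M) {φ : ℝ × M → ℝ}
    (hφ : ContMDiff (𝓘(ℝ, ℝ).prod 𝓘(ℝ, E)) 𝓘(ℝ, ℝ) ∞ φ) :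
    Continuous (S.transportIntegrand φ) := by
  have h1 : Continuous (tangentMap (𝓘(ℝ, ℝ).prod 𝓘(ℝ, E)) 𝓘(ℝ, ℝ) φ) :=
    hφ.continuous_tangentMap (by simp)
  have h2 : Continuous (equivTangentBundleProd 𝓘(ℝ, ℝ) ℝ 𝓘(ℝ, E) M).symm :=
    (contMDiff_equivTangentBundleProd_symm (n := 0)).continuous
  have h3 : Continuous fun t : I => (⟨(t : ℝ), (1 : ℝ)⟩ : TangentBundle 𝓘(ℝ, ℝ) ℝ) :=
    (tangentBundleModelSpaceHomeomorph 𝓘(ℝ, ℝ)).symm.continuous.comp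
      (continuous_subtype_val.prodMk continuous_const)
  have h4 : Continuous fun w : TangentBundle 𝓘(ℝ, ℝ) ℝ => (w.2 : ℝ) :=
    continuous_snd.comp (tangentBundleModelSpaceHomeomorph 𝓘(ℝ, ℝ)).continuous
  have h5 : S.transportIntegrand φ = fun p : I × S.HorizontalBundle =>
      (tangentMap (𝓘(ℝ, ℝ).prod 𝓘(ℝ, E)) 𝓘(ℝ, ℝ) φ
        ((equivTangentBundleProd 𝓘(ℝ, ℝ) ℝ 𝓘(ℝ, E) M).symm
          (⟨(p.1 : ℝ), (1 : ℝ)⟩, p.2.1))).2 :=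
    funext fun p => S.transportIntegrand_eq_tangentMap hφ p.1 p.2
  rw [h5]
  exact h4.comp (h1.comp (h2.comp
    ((h3.comp continuous_fst).prodMk (S.continuous_coe.comp continuous_snd))))

/-- The integrand grows at most linearly on the horizontal spaces over a compact set: it is bounded
on the unit balls, which form a compact set, and affine on each horizontal space. -/
theorem exists_abs_transportIntegrand_le [T2Space M] (S : SubRiemannianStructure E M)
    {φ : ℝ × M → ℝ} (hφ : ContMDiff (𝓘(ℝ, ℝ).prod 𝓘(ℝ, E)) 𝓘(ℝ, ℝ) ∞ φ) {K : Set M}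
    (hK : IsCompact K) :
    ∃ C : ℝ, ∀ (t : I) (v : S.HorizontalBundle), proj v ∈ K →
      |S.transportIntegrand φ (t, v)| ≤ C * (1 + hnorm v) := by
  obtain ⟨C, hC⟩ := ((isCompact_univ (X := I)).prod
    (S.isCompact_proj_mem_hnorm_le hK 1)).exists_bound_of_continuousOn
    (S.continuous_transportIntegrand hφ).continuousOn
  have hC' : ∀ (t : I) (x : M) (h : S.H x), x ∈ K → hnorm (S.mkHorizontal x h) ≤ 1 →
      |S.transportIntegrand φ (t, S.mkHorizontal x h)| ≤ max C 0 := fun t x h hx hh =>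
    (hC (t, S.mkHorizontal x h) ⟨mem_univ _, hx, hh⟩).trans (le_max_left _ _)
  refine ⟨2 * max C 0, fun t v hv => ?_⟩
  have hm : 0 ≤ max C 0 := le_max_right _ _
  have hn := hnorm_nonneg v
  rcases le_or_gt (hnorm v) 1 with h1 | h1
  · have := hC' t (proj v) (fiber v) hv h1
    rw [mkHorizontal_fiber] at this
    nlinarith
  -- the integrand is affine on each horizontal space
  have haff : ∀ r : ℝ, S.transportIntegrand φ (t, S.mkHorizontal (proj v) (r • fiber v)) =
      S.transportIntegrand φ (t, S.mkHorizontal (proj v) 0) +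
        r * (S.transportIntegrand φ (t, S.mkHorizontal (proj v) (fiber v)) -
          S.transportIntegrand φ (t, S.mkHorizontal (proj v) 0)) := by
    intro r
    simp only [transportIntegrand_mkHorizontal, map_smul, LinearMap.smul_apply, map_zero,
      LinearMap.zero_apply, smul_eq_mul]
    rw [add_zero, add_sub_cancel_left]
  have hz := hC' t (proj v) 0 hv (by
    have := S.hnorm_mkHorizontal_smul (proj v) 0 0
    simp only [zero_smul, abs_zero, zero_mul] at this
    rw [this]; exact zero_le_one)
  have hu := hC' t (proj v) ((hnorm v)⁻¹ • fiber v) hv (by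
    rw [hnorm_mkHorizontal_smul, mkHorizontal_fiber, abs_of_nonneg (by positivity),
      inv_mul_cancel₀ (by linarith)])
  rw [haff, mkHorizontal_fiber] at hu
  generalize S.transportIntegrand φ (t, S.mkHorizontal (proj v) 0) = z at *
  generalize S.transportIntegrand φ (t, v) = y at *
  have hr : 0 < hnorm v := by linarith
  have hd : |(hnorm v)⁻¹ * (y - z)| ≤ 2 * max C 0 := by
    have := abs_sub (z + (hnorm v)⁻¹ * (y - z)) z
    rw [add_sub_cancel_left] at this
    linarith
  rw [abs_mul, abs_of_pos (inv_pos.2 hr), inv_mul_le_iff₀ hr] at hd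
  have := abs_add_le z (y - z)
  rw [add_sub_cancel] at this
  linarith

end SubRiemannianStructure

end TransportIntegrand

/-! ### Compactness of the set of transport measures of bounded cost -/

section Compactness

namespace SubRiemannianStructure

variable {E : Type*} [NormedAddCommGroup E] [NormedSpace ℝ E] {M : Type*}
  [TopologicalSpace M] [ChartedSpace E M] [IsManifold 𝓘(ℝ, E) ∞ M]

/-- Mass one of the base measure on `I × K` means that `η`-almost every horizontal vector has its
base point in `K`. -/
theorem baseMeasure_univ_prod_eq_one_iff [MeasurableSpace M] [BorelSpace M]
    (S : SubRiemannianStructure E M) {K : Set M} (hK : IsClosed K)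
    (η : ProbabilityMeasure (I × S.HorizontalBundle)) :
    S.baseMeasure η (univ ×ˢ K) = 1 ↔
      (η : Measure (I × S.HorizontalBundle)) {p | proj p.2 ∈ K}ᶜ = 0 := by
  have hm : Measurable fun p : I × S.HorizontalBundle => (p.1, proj p.2) :=
    measurable_fst.prodMk (S.continuous_proj.measurable.comp measurable_snd)
  have hpre : (fun p : I × S.HorizontalBundle => (p.1, proj p.2)) ⁻¹' (univ ×ˢ K) =
      {p | proj p.2 ∈ K} := by
    ext p
    simp
  have hms : MeasurableSet {p : I × S.HorizontalBundle | proj p.2 ∈ K} := by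
    rw [← hpre]
    exact hm (MeasurableSet.univ.prod hK.measurableSet)
  rw [baseMeasure, Measure.map_apply hm (MeasurableSet.univ.prod hK.measurableSet), hpre,
    prob_compl_eq_zero_iff hms]

/-- A function of linear growth on the horizontal spaces over `K` has a second moment bounded in
terms of the cost. -/
theorem lintegral_sq_le_of_relaxedCost_le (S : SubRiemannianStructure E M) {c : ℝ} {K : Set M}
    {η : ProbabilityMeasure (I × S.HorizontalBundle)}
    (hη : (η : Measure (I × S.HorizontalBundle)) {p | proj p.2 ∈ K}ᶜ = 0)
    (hc : S.relaxedCost η ≤ ENNReal.ofReal c) {F : I × S.HorizontalBundle → ℝ} {C : ℝ}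
    (hF : ∀ (t : I) (v : S.HorizontalBundle), proj v ∈ K → |F (t, v)| ≤ C * (1 + hnorm v)) :
    ∫⁻ p, ENNReal.ofReal (F p ^ 2) ∂(η : Measure (I × S.HorizontalBundle)) ≤
      ENNReal.ofReal (2 * C ^ 2 * (1 + max c 0)) := by
  have hae : ∀ᵐ p ∂(η : Measure (I × S.HorizontalBundle)), ENNReal.ofReal (F p ^ 2) ≤
      ENNReal.ofReal (2 * C ^ 2) * (1 + ENNReal.ofReal (hnorm p.2 ^ 2)) := by
    have hK : ∀ᵐ p ∂(η : Measure (I × S.HorizontalBundle)), proj p.2 ∈ K := hη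
    filter_upwards [hK] with p hp
    rw [← ENNReal.ofReal_one, ← ENNReal.ofReal_add zero_le_one (sq_nonneg _),
      ← ENNReal.ofReal_mul (by positivity)]
    refine ENNReal.ofReal_le_ofReal ?_
    calc F p ^ 2 ≤ (C * (1 + hnorm p.2)) ^ 2 := sq_le_sq.2 ((hF p.1 p.2 hp).trans (le_abs_self _))
      _ = C ^ 2 * (1 + hnorm p.2) ^ 2 := by ring
      _ ≤ C ^ 2 * (2 * (1 + hnorm p.2 ^ 2)) := by
        gcongr
        nlinarith [sq_nonneg (hnorm p.2 - 1)]
      _ = _ := by ring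
  refine (lintegral_mono_ae hae).trans ?_
  rw [lintegral_const_mul' _ _ ENNReal.ofReal_ne_top, lintegral_add_left measurable_const,
    lintegral_const, measure_univ, one_mul, ENNReal.ofReal_mul (p := 2 * C ^ 2) (by positivity),
    ENNReal.ofReal_add zero_le_one (le_max_right _ _), ENNReal.ofReal_one]
  gcongr
  exact hc.trans (ENNReal.ofReal_le_ofReal (le_max_left _ _))

variable [FiniteDimensional ℝ E]

/-- Chebyshev's inequality: sets of bounded horizontal vectors over `K` carry almost all the mass,
uniformly among measures of bounded cost that live over `K`. -/
theorem measure_compl_le_of_relaxedCost_le (S : SubRiemannianStructure E M) {c : ℝ≥0∞} {K : Set M}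
    {η : ProbabilityMeasure (I × S.HorizontalBundle)}
    (hη : (η : Measure (I × S.HorizontalBundle)) {p | proj p.2 ∈ K}ᶜ = 0)
    (hc : S.relaxedCost η ≤ c) (n : ℕ) :
    (η : Measure (I × S.HorizontalBundle))
      (univ ×ˢ {v : S.HorizontalBundle | proj v ∈ K ∧ hnorm v ≤ n + 1})ᶜ ≤ c / (n + 1) := by
  have hsub : (univ ×ˢ {v : S.HorizontalBundle | proj v ∈ K ∧ hnorm v ≤ n + 1} :
      Set (I × S.HorizontalBundle))ᶜ ⊆ {p | proj p.2 ∈ K}ᶜ ∪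
        {p | ((n + 1 : ℕ) : ℝ≥0∞) ≤ ENNReal.ofReal (hnorm p.2 ^ 2)} := by
    intro p hp
    by_cases hpK : proj p.2 ∈ K
    · refine Or.inr ?_
      have h1 : ((n : ℝ) + 1) < hnorm p.2 := not_le.1 fun h => hp ⟨mem_univ _, hpK, h⟩
      rw [mem_ofPred_eq, ← ENNReal.ofReal_natCast]
      refine ENNReal.ofReal_le_ofReal ?_
      push_cast
      nlinarith [Nat.cast_nonneg (α := ℝ) n]
    · exact Or.inl hpK
  refine (measure_mono hsub).trans ((measure_union_le _ _).trans ?_)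
  rw [hη, zero_add]
  refine (meas_ge_le_lintegral_div (ENNReal.measurable_ofReal.comp
    ((S.continuous_hnorm.comp continuous_snd).pow 2).measurable).aemeasurable
    (by simp) (ENNReal.natCast_ne_top _)).trans ?_
  rw [Nat.cast_add, Nat.cast_one]
  exact ENNReal.div_le_div_right hc _

end SubRiemannianStructure

end Compactness

open SubRiemannianStructure in
theorem mainTheorem8 {E : Type*} [NormedAddCommGroup E] [NormedSpace ℝ E] [FiniteDimensional ℝ E]
    {M : Type*} [TopologicalSpace M] [T2Space M] [SecondCountableTopology M]
    [ChartedSpace E M] [IsManifold 𝓘(ℝ, E) ∞ M] [MeasurableSpace M] [BorelSpace M]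
    (S : SubRiemannianStructure E M) (c : ℝ) (K : Set M) (hK : IsCompact K)
    (μ₀ μ₁ : ProbabilityMeasure M)
    (hμ₀ : IsCompact (μ₀ : Measure M).support) (hμ₁ : IsCompact (μ₁ : Measure M).support) :
    IsCompact {η : ProbabilityMeasure (I × S.HorizontalBundle) |
      η ∈ S.youngTransport μ₀ μ₁ ∧ (S.relaxedCost η : EReal) ≤ (c : EReal) ∧
        S.baseMeasure η (univ ×ˢ K) = 1} := by
  rcases lt_or_ge c 0 with hc | hc
  -- a negative `c` bounds no cost, and the set is empty
  · convert isCompact_empty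
    refine eq_empty_iff_forall_notMem.2 fun η hη => ?_
    have h := (EReal.coe_ennreal_nonneg _).trans hη.2.1
    exact absurd (EReal.coe_nonneg.1 h) (not_le.2 hc)
  have hcost : ∀ η : ProbabilityMeasure (I × S.HorizontalBundle),
      (S.relaxedCost η : EReal) ≤ (c : EReal) ↔ S.relaxedCost η ≤ ENNReal.ofReal c := by
    intro η
    rw [← EReal.coe_ennreal_le_coe_ennreal_iff, EReal.coe_ennreal_ofReal, max_eq_left hc]
  let D : ℕ → Set (I × S.HorizontalBundle) := fun n =>
    univ ×ˢ {v : S.HorizontalBundle | proj v ∈ K ∧ hnorm v ≤ n + 1}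
  have hD : ∀ n, IsCompact (D n) := fun n =>
    isCompact_univ.prod (S.isCompact_proj_mem_hnorm_le hK _)
  have hDmono : Monotone D := fun m n hmn p hp => ⟨mem_univ _, hp.2.1, hp.2.2.trans (by gcongr)⟩
  let u : ℕ → NNReal := fun n => c.toNNReal / (n + 1)
  have hu : Tendsto u atTop (𝓝 0) := by
    have h := tendsto_const_div_atTop_nhds_zero_nat c.toNNReal
    simpa [u, Function.comp_def] using h.comp (tendsto_add_atTop_nat 1)
  have hucoe : ∀ n, (u n : ℝ≥0∞) = ENNReal.ofReal c / (n + 1) := fun n => by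
    rw [ENNReal.coe_div (by positivity)]
    push_cast
    rfl
  -- Prokhorov's theorem: the measures with mass at most `u n` outside `D n` form a compact set
  have hT := isCompact_setOfPred_probabilityMeasure_mass_eq_compl_isCompact_le hu hD (Or.inr hDmono)
  choose C hC using fun (φ : ℝ × M → ℝ)
    (hφ : ContMDiff (𝓘(ℝ, ℝ).prod 𝓘(ℝ, E)) 𝓘(ℝ, ℝ) ∞ φ) =>
      S.exists_abs_transportIntegrand_le hφ hK
  -- the bound on the second moment of the integrand implied by cost at most `c` and support over `K`
  let B : ∀ φ : ℝ × M → ℝ, ContMDiff (𝓘(ℝ, ℝ).prod 𝓘(ℝ, E)) 𝓘(ℝ, ℝ) ∞ φ →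
      Set (ProbabilityMeasure (I × S.HorizontalBundle)) := fun φ hφ =>
    {η | ∫⁻ p, ENNReal.ofReal (S.transportIntegrand φ p ^ 2)
      ∂(η : Measure (I × S.HorizontalBundle)) ≤ ENNReal.ofReal (2 * C φ hφ ^ 2 * (1 + max c 0))}
  have hBclosed : ∀ φ hφ, IsClosed (B φ hφ ∩ {η |
      ∫ p, S.transportIntegrand φ p ∂(η : Measure (I × S.HorizontalBundle)) =
        ∫ x, φ (1, x) ∂(μ₁ : Measure M) - ∫ x, φ (0, x) ∂(μ₀ : Measure M)}) := fun φ hφ =>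
    (continuousOn_integral_of_lintegral_sq_le (S.continuous_transportIntegrand hφ)
      _).preimage_isClosed_of_isClosed
      (isClosed_setOf_lintegral_le_of_continuous ((S.continuous_transportIntegrand hφ).pow 2) _)
      isClosed_singleton
  have hcostClosed : IsClosed {η | S.relaxedCost η ≤ ENNReal.ofReal c} :=
    isClosed_setOf_lintegral_le_of_continuous ((S.continuous_hnorm.comp continuous_snd).pow 2) _
  have hclosed := (isClosed_youngMeasures (X := S.HorizontalBundle)).inter (hcostClosed.inter
    (isClosed_iInter fun φ => isClosed_iInter fun hφ =>
      isClosed_iInter fun _ : HasCompactSupport φ => hBclosed φ hφ))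
  convert hT.inter_right hclosed using 1
  ext η
  constructor
  · rintro ⟨⟨hy, hφ⟩, hηc, hηK⟩
    rw [hcost] at hηc
    rw [S.baseMeasure_univ_prod_eq_one_iff hK.isClosed] at hηK
    refine ⟨fun n => ?_, hy, hηc, ?_⟩
    · rw [← ENNReal.coe_le_coe, ProbabilityMeasure.ennreal_coeFn_eq_coeFn_toMeasure, hucoe]
      exact S.measure_compl_le_of_relaxedCost_le hηK hηc n
    · simp only [mem_iInter]
      exact fun φ hφs hφc =>
        ⟨S.lintegral_sq_le_of_relaxedCost_le hηK hηc (hC φ hφs), (hφ φ hφs hφc).2⟩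
  · rintro ⟨hηT, hy, hηc, hηφ⟩
    simp only [mem_iInter] at hηφ
    refine ⟨⟨hy, fun φ hφs hφc => ⟨?_, (hηφ φ hφs hφc).2⟩⟩, (hcost η).2 hηc, ?_⟩
    · exact (integrable_of_lintegral_sq_le (S.continuous_transportIntegrand hφs)
        (hηφ φ hφs hφc).1).1
    · rw [S.baseMeasure_univ_prod_eq_one_iff hK.isClosed]
      -- all the sets `D n` lie over `K`, so the mass outside `π⁻¹(K)` is at most `u n` for all `n`
      have hlim : Tendsto (fun n => (u n : ℝ≥0∞)) atTop (𝓝 0) := by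
        rw [← ENNReal.coe_zero]
        exact ENNReal.tendsto_coe.2 hu
      refine le_antisymm (ge_of_tendsto' hlim fun n => ?_) zero_le
      refine (measure_mono (compl_subset_compl.2 fun p hp => hp.2.1 :
        {p : I × S.HorizontalBundle | proj p.2 ∈ K}ᶜ ⊆ (D n)ᶜ)).trans ?_
      rw [← ProbabilityMeasure.ennreal_coeFn_eq_coeFn_toMeasure]
      exact ENNReal.coe_le_coe.2 (hηT n)
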